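/- Let $\bar v>0$, let $n\ge 1$ and $K\ge 0$ be integers, and let $\phi_1,\dots,\phi_K:[0,\bar v]\to\mathbb R$ be bounded and such that, for each $k$, $[0,\bar v]$ splits into finitely many intervals on each of which $\phi_k$ is continuous and nondecreasing. Let $$\mathcal F=\Big\{F \text{ a probability measure on } [0,\bar v]:\ \int_{[0,\bar v]}\phi_k\,dF\ge 0,\ k=1,\dots,K\Big\},$$ and assume that there is $F\in\mathcal F$ with $\int\phi_k\,dF>0$ for every $k$ for which $\phi_k$ is not a step function (i.e. takes infinitely many values); in particular $\mathcal F\neq\emptyset$. Let $\Pi_n$ be the set of price distributions $\pi=\sum_{i=1}^n x_i\delta_{v_i}$ with $0\le v_1\le\dots\le v_n\le\bar v$, $x_i\in[0,1]$ and $\sum_i x_i=1$. A buyer with valuation $v$ pays $t_\pi(v)=\int_0^v u\,\pi(u)\,du=\sum_{i:\,v_i\le v}x_iv_i$ in expectation. Let $\mathrm{Rev}(\pi,F)=\int_{[0,\bar v]}t_\pi\,dF$, let $\mathrm{Rev}(\mathrm{OPT},F)=\max_{p\in[0,\bar v]}p\,(1-F(p-))$ with $F(p-)=F([0,p))$, and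 let $$\mathrm{CR}(\pi)=\inf_{F\in\mathcal F,\ \mathrm{Rev}(\mathrm{OPT},F)>0}\ \frac{\mathrm{Rev}(\pi,F)}{\mathrm{Rev}(\mathrm{OPT},F)}\in[0,+\infty]$$ (the only distribution left out is the point mass at $0$, for which the ratio is $0/0$; $\inf\emptyset=+\infty$). Then the $n$-level robust pricing problem $\sup_{\pi\in\Pi_n}\mathrm{CR}(\pi)$ is equivalent to the semi-infinite program $$\begin{aligned}\sup\ & r\qquad\text{over } r\in\mathbb R,\ \pi\in\Pi_n,\ \lambda_k:[0,\bar v]\to[0,\infty)\ (k=1,\dots,K)\\ \text{s.t. } & \sum_{k=1}^K\phi_k(v)\lambda_k(p)\le t_\pi(v)\quad\forall p\in[0,\bar v],\ \forall v\in[0,p),\\ & r\,p+\sum_{k=1}^K\phi_k(v)\lambda_k(p)\le t_\pi(v)\quad\forall p\in[0,\bar v],\ \forall v\in[p,\bar v],\end{aligned}$$ in the following sense. 1. The two problems have the same value in $[0,+\infty]$. 2. For each $\pi\in\Pi_n$ and $r\in\mathbb R$, there is $\lambda$ such that $(r,\pi,\lambda)$ is feasible for the program if and only if $r\le\mathrm{CR}(\pi)$.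 3. For each $r\in\mathbb R$ and each price distribution $\pi$, there is $\lambda$ such that $(r,\pi,\lambda)$ is an optimal solution of the program if and only if $\pi\in\Pi_n$ and $\mathrm{CR}(\pi)=r=\sup_{\pi'\in\Pi_n}\mathrm{CR}(\pi')$; that is, the optimal $r$ is the optimal competitive ratio and $\pi$ is a corresponding optimal price distribution. -/

import Mathlib

open MeasureTheory

noncomputable section

namespace RobustPricing

/-- The function `φ` is bounded on `[0, vbar]`, and `[0, vbar]` is a finite union of segments
(intervals with or without their endpoints, possibly single points), on each of which `φ` is
continuous and nondecreasing. -/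
def PiecewiseNondecreasing (vbar : ℝ) (φ : ℝ → ℝ) : Prop :=
  (∃ M : ℝ, ∀ v ∈ Set.Icc 0 vbar, |φ v| ≤ M) ∧
  ∃ (m : ℕ) (I : Fin m → Set ℝ),
    (⋃ j, I j) = Set.Icc 0 vbar ∧
    ∀ j, (I j).OrdConnected ∧ ContinuousOn φ (I j) ∧ MonotoneOn φ (I j)

/-- The ambiguity set: all probability measures `F` on `[0, vbar]` (seen as measures on the line
that are concentrated on `[0, vbar]`) with `∫ φ k dF ≥ 0` for all `k`. -/
def ambiguitySet (vbar : ℝ) {K : ℕ} (φ : Fin K → ℝ → ℝ) : Set (Measure ℝ) :=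
  {F | IsProbabilityMeasure F ∧ F (Set.Icc 0 vbar)ᶜ = 0 ∧
    ∀ k, 0 ≤ ∫ v in Set.Icc 0 vbar, φ k v ∂F}

/-- The `n`-level pricing mechanisms `∑ x i • δ_(v i)`: price `v i ∈ [0, vbar]` is posted with
probability `x i`. -/
def nLevelPricing (vbar : ℝ) (n : ℕ) : Set (Measure ℝ) :=
  {π | ∃ v x : Fin n → ℝ, Monotone v ∧ (∀ i, v i ∈ Set.Icc 0 vbar) ∧
    (∀ i, x i ∈ Set.Icc (0 : ℝ) 1) ∧ ∑ i, x i = 1 ∧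
    π = ∑ i, ENNReal.ofReal (x i) • Measure.dirac (v i)}

/-- The expected payment `∫_0^v u π(u) du` of a buyer with valuation `v`; an atom of `π` at `v`
counts, since a buyer whose valuation equals the price buys. -/
def payment (π : Measure ℝ) (v : ℝ) : ℝ :=
  ∫ u in Set.Icc 0 v, u ∂π

/-- The expected revenue of the mechanism `π` under the valuation distribution `F`. -/
def revenue (vbar : ℝ) (π F : Measure ℝ) : ℝ :=
  ∫ v in Set.Icc 0 vbar, payment π v ∂F

/-- The clairvoyant revenue `max_{p ∈ [0, vbar]} p (1 - F(p-))`, where `F(p-) = F((-∞, p))`. -/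
def optRevenue (vbar : ℝ) (F : Measure ℝ) : ℝ :=
  sSup ((fun p : ℝ => p * (1 - F.real (Set.Iio p))) '' Set.Icc 0 vbar)

/-- The competitive ratio of `π`: the infimum of `revenue / optRevenue` over the ambiguity set.
The ratio is `0 / 0` exactly when `F` is the point mass at `0`; this `F` is left out. -/
def competitiveRatio (vbar : ℝ) {K : ℕ} (φ : Fin K → ℝ → ℝ) (π : Measure ℝ) : EReal :=
  ⨅ F ∈ {F ∈ ambiguitySet vbar φ | 0 < optRevenue vbar F},
    ((revenue vbar π F / optRevenue vbar F : ℝ) : EReal)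

/-- The value of the `n`-level robust pricing problem. -/
def robustValue (vbar : ℝ) (n : ℕ) {K : ℕ} (φ : Fin K → ℝ → ℝ) : EReal :=
  ⨆ π ∈ nLevelPricing vbar n, competitiveRatio vbar φ π

/-- Feasibility of `(r, π, lam)` in the semi-infinite program; only the values `lam k p` with
`p ∈ [0, vbar]` matter. -/
structure IsFeasible (vbar : ℝ) (n : ℕ) {K : ℕ} (φ : Fin K → ℝ → ℝ)
    (r : ℝ) (π : Measure ℝ) (lam : Fin K → ℝ → ℝ) : Prop where
  mem : π ∈ nLevelPricing vbar n
  nonneg : ∀ k, ∀ p ∈ Set.Icc 0 vbar, 0 ≤ lam k p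
  below : ∀ p ∈ Set.Icc 0 vbar, ∀ v ∈ Set.Ico 0 p,
    ∑ k, φ k v * lam k p ≤ payment π v
  above : ∀ p ∈ Set.Icc 0 vbar, ∀ v ∈ Set.Icc p vbar,
    r * p + ∑ k, φ k v * lam k p ≤ payment π v

/-- The value of the semi-infinite program: the supremum of `r` over all feasible points. -/
def programValue (vbar : ℝ) (n : ℕ) {K : ℕ} (φ : Fin K → ℝ → ℝ) : EReal :=
  sSup {s : EReal | ∃ (r : ℝ) (π : Measure ℝ) (lam : Fin K → ℝ → ℝ),
    IsFeasible vbar n φ r π lam ∧ s = (r : EReal)}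

/-- `(r, π, lam)` is an optimal solution of the semi-infinite program. -/
def IsOptimalSolution (vbar : ℝ) (n : ℕ) {K : ℕ} (φ : Fin K → ℝ → ℝ)
    (r : ℝ) (π : Measure ℝ) (lam : Fin K → ℝ → ℝ) : Prop :=
  IsFeasible vbar n φ r π lam ∧
    ∀ (r' : ℝ) (π' : Measure ℝ) (lam' : Fin K → ℝ → ℝ),
      IsFeasible vbar n φ r' π' lam' → r' ≤ r

/-- The constraint qualification: some `F` in the ambiguity set (which is thus nonempty) satisfies
strictly every moment constraint whose `φ k` is not a step function. -/
def IsRegular (vbar : ℝ) {K : ℕ} (φ : Fin K → ℝ → ℝ) : Prop :=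
  ∃ F ∈ ambiguitySet vbar φ, ∀ k,
    (φ k '' Set.Icc 0 vbar).Finite ∨ 0 < ∫ v in Set.Icc 0 vbar, φ k v ∂F

end RobustPricing

end

namespace RobustPricing

open Set

/-! Fix `π` and `r ≥ 0`. Since the clairvoyant revenue is a supremum over `p`, the bound `r ≤ CR(π)`
says that, for each `p` separately, `g = t_π - r p 1_{[p,∞)}` has nonnegative integral over the
ambiguity set. Strong duality for this moment problem (`exists_multipliers`) turns that into the
existence of multipliers `λ(p)`. Duality is finite-dimensional here: `g` has finitely many values,
so `[0, vbar]` is covered by finitely many cells on which `g` is constant and every `φ k` is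
nondecreasing. On a cell all `φ k` approach their suprema together, so only the suprema constrain
the multipliers. If that finite system has no solution, Farkas gives weights on the cells; atoms far
enough to the right in each cell violate `∫ g ≥ 0`. The suprema are attained for step functions; for
the others a small error remains, absorbed by adding the regular measure. -/

/-! ### Linear inequalities -/

/-- **Farkas' lemma** for finitely many linear functionals on a real vector space. -/
theorem exists_nonneg_combination {V ι : Type*} [AddCommGroup V] [Module ℝ V]
    (s : Finset ι) (A : ι → V →ₗ[ℝ] ℝ) (γ : V →ₗ[ℝ] ℝ)
    (h : ∀ x, (∀ i ∈ s, 0 ≤ A i x) → 0 ≤ γ x) :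
    ∃ c : ι → ℝ, (∀ i, 0 ≤ c i) ∧ ∀ x, γ x = ∑ i ∈ s, c i * A i x := by
  classical
  induction s using Finset.induction_on generalizing A γ with
  | empty =>
    refine ⟨0, fun _ => le_rfl, fun x => ?_⟩
    have h₁ := h x (by simp)
    have h₂ := h (-x) (by simp)
    rw [map_neg] at h₂
    simp only [Finset.sum_empty]
    linarith
  | insert m s hm ih =>
    by_cases hs : ∀ x, (∀ i ∈ s, 0 ≤ A i x) → 0 ≤ γ x
    · obtain ⟨c, hc, hγ⟩ := ih A γ hs
      refine ⟨Function.update c m 0, fun i => ?_, fun x => ?_⟩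
      · by_cases hi : i = m
        · simp [hi]
        · simpa [Function.update_of_ne hi] using hc i
      · rw [Finset.sum_insert hm, hγ x]
        simp only [Function.update_self, zero_mul, zero_add]
        refine Finset.sum_congr rfl fun i hi => ?_
        rw [Function.update_of_ne (ne_of_mem_of_not_mem hi hm)]
    · push Not at hs
      obtain ⟨x, hx, hγx⟩ := hs
      have hmx : A m x < 0 := by
        by_contra hcon
        exact hγx.not_ge (h x (by simpa using ⟨not_lt.1 hcon, hx⟩))
      -- Projection along `x` onto the kernel of `A m`, where the constraint `m` is void.
      let P : V →ₗ[ℝ] V := LinearMap.id - ((A m x)⁻¹ • (A m)).smulRight x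
      have hP : ∀ y, P y = y - ((A m x)⁻¹ * A m y) • x := fun y => by simp [P]
      have hAP : ∀ y, A m (P y) = 0 := fun y => by
        rw [hP, map_sub, map_smul, smul_eq_mul]
        field_simp [hmx.ne]
        ring
      obtain ⟨c, hc, hγ⟩ := ih (fun i => (A i).comp P) (γ.comp P) fun y hy => h (P y) (by
        simpa [hAP y] using hy)
      -- `γ - ∑ c i • A i` vanishes on the kernel of `A m`, so it is a multiple of `A m`; evaluating
      -- at `x` gives the factor.
      set d := (A m x)⁻¹ * (γ x - ∑ i ∈ s, c i * A i x) with hd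
      have hd0 : 0 ≤ d := by
        refine mul_nonneg_of_nonpos_of_nonpos (inv_nonpos.2 hmx.le) ?_
        have := Finset.sum_nonneg fun i hi => mul_nonneg (hc i) (hx i hi)
        linarith
      refine ⟨Function.update c m d, fun i => ?_, fun y => ?_⟩
      · by_cases hi : i = m
        · simpa [hi] using hd0
        · simpa [Function.update_of_ne hi] using hc i
      · have key := hγ y
        simp only [LinearMap.comp_apply, hP, map_sub, map_smul, smul_eq_mul, mul_sub,
          Finset.sum_sub_distrib] at key
        rw [Finset.sum_insert hm, Function.update_self]
        have h₁ : ∑ i ∈ s, Function.update c m d i * A i y = ∑ i ∈ s, c i * A i y :=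
          Finset.sum_congr rfl fun i hi => by
            rw [Function.update_of_ne (ne_of_mem_of_not_mem hi hm)]
        have h₂ : ∑ i ∈ s, c i * ((A m x)⁻¹ * A m y * A i x) =
            (A m x)⁻¹ * A m y * ∑ i ∈ s, c i * A i x := by
          rw [Finset.mul_sum]
          exact Finset.sum_congr rfl fun i _ => by ring
        rw [h₁, hd]
        rw [h₂] at key
        linear_combination key

/-- The theorem of the alternative for a system `a *ᵥ c ≤ b`, `0 ≤ c`. -/
theorem exists_nonneg_solution_or_certificate {ι κ : Type*} [Fintype ι] [Fintype κ]
    (a : ι → κ → ℝ) (b : ι → ℝ) :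
    (∃ c : κ → ℝ, (∀ k, 0 ≤ c k) ∧ ∀ i, ∑ k, a i k * c k ≤ b i) ∨
    ∃ y : ι → ℝ, (∀ i, 0 ≤ y i) ∧ (∀ k, 0 ≤ ∑ i, y i * a i k) ∧ ∑ i, y i * b i < 0 := by
  classical
  by_contra! hcon
  obtain ⟨h₁, h₂⟩ := hcon
  -- Farkas in the space of certificates `y`: the coefficients of the columns of `a` solve the
  -- system, those of the coordinates are its slacks.
  obtain ⟨c, hc, hγ⟩ := exists_nonneg_combination (V := ι → ℝ) Finset.univ
    (Sum.elim (fun k => ∑ i, a i k • LinearMap.proj i) fun i => LinearMap.proj i)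
    (∑ i, b i • LinearMap.proj i : (ι → ℝ) →ₗ[ℝ] ℝ) (fun y hy => by
      have := h₂ y (fun i => by simpa using hy (Sum.inr i) (Finset.mem_univ _))
        (fun k => by simpa [mul_comm] using hy (Sum.inl k) (Finset.mem_univ _))
      simpa [mul_comm] using this)
  obtain ⟨i, hi⟩ := h₁ (fun k => c (Sum.inl k)) fun k => hc _
  have := hγ (Pi.single i 1)
  simp [Fintype.sum_sum_type, Pi.single_apply] at this
  have hci := hc (Sum.inr i)
  have : ∑ k, a i k * c (Sum.inl k) = ∑ k, c (Sum.inl k) * a i k :=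
    Finset.sum_congr rfl fun k _ => mul_comm _ _
  linarith

/-! ### Duality for the moment problem -/

/-- Integration against a finitely supported measure. -/
theorem setIntegral_sum_dirac {ι : Type*} [Fintype ι] (y v : ι → ℝ) (hy : ∀ i, 0 ≤ y i)
    (s : Set ℝ) (hs : MeasurableSet s) (f : ℝ → ℝ) :
    ∫ u in s, f u ∂(∑ i, ENNReal.ofReal (y i) • Measure.dirac (v i)) =
      ∑ i, y i * s.indicator f (v i) := by
  rw [← integral_indicator hs, integral_finsetSum_measure]
  · refine Finset.sum_congr rfl fun i _ => ?_
    rw [integral_smul_measure, integral_dirac, ENNReal.toReal_ofReal (hy i), smul_eq_mul]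
  · exact fun i _ => (integrable_dirac (by simp)).smul_measure ENNReal.ofReal_ne_top

/-- Continuity on the pieces serves only to give measurability. -/
theorem PiecewiseNondecreasing.integrableOn {vbar : ℝ} {φ : ℝ → ℝ}
    (h : PiecewiseNondecreasing vbar φ) (F : Measure ℝ) [IsFiniteMeasure F] :
    IntegrableOn φ (Icc 0 vbar) F := by
  obtain ⟨⟨M, hM⟩, m, I, hI, hcell⟩ := h
  refine Integrable.of_bound (C := M) ?_ ?_
  · rw [← hI, aestronglyMeasurable_iUnion_iff]
    exact fun j => (hcell j).2.1.aestronglyMeasurable (hcell j).1.measurableSet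
  · exact (ae_restrict_mem measurableSet_Icc).mono hM

/-- Finitely many bounded functions that are nondecreasing on `J` are simultaneously within `ε` of
their suprema at some point of `J`, and at their suprema if they take finitely many values. -/
theorem exists_forall_sSup_sub_lt {κ : Type*} [Finite κ] {J : Set ℝ} (hJ : J.Nonempty)
    {f : κ → ℝ → ℝ} (hf : ∀ k, MonotoneOn (f k) J) (hbdd : ∀ k, BddAbove (f k '' J))
    {ε : ℝ} (hε : 0 < ε) :
    ∃ v ∈ J, ∀ k, sSup (f k '' J) - ε < f k v ∧
      ((f k '' J).Finite → f k v = sSup (f k '' J)) := by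
  have hk : ∀ k, ∃ v : J, sSup (f k '' J) - ε < f k v ∧
      ((f k '' J).Finite → f k v = sSup (f k '' J)) := fun k => by
    by_cases hfin : (f k '' J).Finite
    · obtain ⟨v, hv, hvs⟩ := (hJ.image (f k)).csSup_mem hfin
      exact ⟨⟨v, hv⟩, by rw [hvs]; linarith, fun _ => hvs⟩
    · obtain ⟨_, ⟨v, hv, rfl⟩, hlt⟩ := exists_lt_of_lt_csSup (hJ.image (f k))
        (sub_lt_self (sSup (f k '' J)) hε)
      exact ⟨⟨v, hv⟩, hlt, fun h => absurd h hfin⟩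
  choose w hw using hk
  have : Nonempty J := hJ.to_subtype
  -- A point to the right of all the individual near-maximizers serves every `f k` by monotonicity.
  obtain ⟨v, hv⟩ := Finite.exists_le w
  refine ⟨v, v.2, fun k => ?_⟩
  have hle := hf k (w k).2 v.2 (hv k)
  refine ⟨(hw k).1.trans_le hle, fun hfin => le_antisymm ?_ ?_⟩
  · exact le_csSup (hbdd k) ⟨v, v.2, rfl⟩
  · rw [← (hw k).2 hfin]
    exact hle

/-- A common partition of `[0, vbar]` into finitely many cells, on each of which finitely many
piecewise nondecreasing functions are nondecreasing and a function `g` with finitely many values is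
constant. -/
theorem exists_common_cells {vbar : ℝ} {K : ℕ} {φ : Fin K → ℝ → ℝ}
    (hφ : ∀ k, PiecewiseNondecreasing vbar (φ k)) {g : ℝ → ℝ} (hg : (g '' Icc 0 vbar).Finite) :
    ∃ (ι : Type) (_ : Fintype ι) (J : ι → Set ℝ) (b : ι → ℝ),
      (∀ i, (J i).Nonempty) ∧ (∀ i, J i ⊆ Icc 0 vbar) ∧ (∀ v ∈ Icc 0 vbar, ∃ i, v ∈ J i) ∧
      (∀ i k, MonotoneOn (φ k) (J i)) ∧ ∀ i, ∀ v ∈ J i, g v = b i := by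
  choose m I hI hcell using fun k => (hφ k).2
  have := hg.to_subtype
  -- A cell fixes one piece for each `φ k` and one value of `g`. Cells may overlap; empty ones are
  -- dropped.
  let J : ((∀ k, Fin (m k)) × (g '' Icc 0 vbar)) → Set ℝ :=
    fun i => {v ∈ Icc 0 vbar | (∀ k, v ∈ I k (i.1 k)) ∧ g v = i.2}
  refine ⟨{i // (J i).Nonempty}, Fintype.ofFinite _, fun i => J i, fun i => i.1.2,
    fun i => i.2, fun i v hv => hv.1, fun v hv => ?_, fun i k => ?_, fun i v hv => hv.2.2⟩
  · have hk : ∀ k, ∃ j, v ∈ I k j := fun k => by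
      rw [← mem_iUnion, hI k]
      exact hv
    choose j hj using hk
    have hvJ : v ∈ J (j, ⟨g v, v, hv, rfl⟩) := ⟨hv, hj, rfl⟩
    exact ⟨⟨_, v, hvJ⟩, hvJ⟩
  · exact (hcell k _).2.2.mono fun v hv => hv.2.1 k

/-- Nonnegativity of `∫ g` on the ambiguity set extends to unnormalized measures. -/
theorem setIntegral_nonneg_of_forall_mem_ambiguitySet {vbar : ℝ} {K : ℕ} {φ : Fin K → ℝ → ℝ}
    {g : ℝ → ℝ} (h : ∀ F ∈ ambiguitySet vbar φ, 0 ≤ ∫ v in Icc 0 vbar, g v ∂F)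
    (μ : Measure ℝ) [IsFiniteMeasure μ] (hμ : μ (Icc 0 vbar)ᶜ = 0)
    (hφμ : ∀ k, 0 ≤ ∫ v in Icc 0 vbar, φ k v ∂μ) : 0 ≤ ∫ v in Icc 0 vbar, g v ∂μ := by
  rcases eq_or_ne μ 0 with rfl | h0
  · simp
  have hpos : 0 < ((μ univ)⁻¹).toReal := ENNReal.toReal_pos
    (ENNReal.inv_ne_zero.2 (measure_ne_top _ _)) (ENNReal.inv_ne_top.2 (by simpa using h0))
  have hint : ∀ f : ℝ → ℝ, ∫ v in Icc 0 vbar, f v ∂((μ univ)⁻¹ • μ) =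
      ((μ univ)⁻¹).toReal * ∫ v in Icc 0 vbar, f v ∂μ := fun f => by
    rw [Measure.restrict_smul, integral_smul_measure, smul_eq_mul]
  have : NeZero μ := ⟨h0⟩
  have := h ((μ univ)⁻¹ • μ) ⟨inferInstance, by simp [hμ], fun k => by
    rw [hint]
    exact mul_nonneg hpos.le (hφμ k)⟩
  rw [hint] at this
  exact nonneg_of_mul_nonneg_right this hpos

/-- Strong duality for the moment problem with a finitely valued objective. -/
theorem exists_multipliers {vbar : ℝ} {K : ℕ} {φ : Fin K → ℝ → ℝ}
    (hφ : ∀ k, PiecewiseNondecreasing vbar (φ k)) (hreg : IsRegular vbar φ)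
    {g : ℝ → ℝ} (hg : (g '' Icc 0 vbar).Finite) (hgm : Measurable g)
    (h : ∀ F ∈ ambiguitySet vbar φ, 0 ≤ ∫ v in Icc 0 vbar, g v ∂F) :
    ∃ c : Fin K → ℝ, (∀ k, 0 ≤ c k) ∧ ∀ v ∈ Icc 0 vbar, ∑ k, φ k v * c k ≤ g v := by
  obtain ⟨ι, _, J, b, hne, hJ, hcover, hmono, hb⟩ := exists_common_cells hφ hg
  have hbdd : ∀ i k, BddAbove (φ k '' J i) := fun i k => by
    obtain ⟨M, hM⟩ := (hφ k).1
    refine ⟨M, ?_⟩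
    rintro _ ⟨v, hv, rfl⟩
    exact (abs_le.1 (hM v (hJ i hv))).2
  rcases exists_nonneg_solution_or_certificate (fun i k => sSup (φ k '' J i)) b with
    ⟨c, hc, hcb⟩ | ⟨y, hy, hya, hyb⟩
  · refine ⟨c, hc, fun v hv => ?_⟩
    obtain ⟨i, hi⟩ := hcover v hv
    rw [hb i v hi]
    refine le_trans (Finset.sum_le_sum fun k _ => ?_) (hcb i)
    exact mul_le_mul_of_nonneg_right (le_csSup (hbdd i k) ⟨v, hi, rfl⟩) (hc k)
  exfalso
  obtain ⟨F, ⟨hF, hFI, hFφ⟩, hFreg⟩ := hreg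
  have hgint : IntegrableOn g (Icc 0 vbar) F := by
    obtain ⟨M, hM⟩ := (hg.image (fun t => |t|)).bddAbove
    exact Integrable.of_bound (C := M) hgm.aestronglyMeasurable
      ((ae_restrict_mem measurableSet_Icc).mono fun v hv => hM ⟨g v, ⟨v, hv, rfl⟩, rfl⟩)
  -- rescale the certificate so that it outweighs the regular measure
  obtain ⟨N, hN0, hN⟩ : ∃ N : ℝ, 0 ≤ N ∧
      N * ∑ i, y i * b i + ∫ v in Icc 0 vbar, g v ∂F < 0 := by
    refine ⟨(|∫ v in Icc 0 vbar, g v ∂F| + 1) / -(∑ i, y i * b i),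
      div_nonneg (by positivity) (by linarith), ?_⟩
    have := le_abs_self (∫ v in Icc 0 vbar, g v ∂F)
    rw [div_mul_eq_mul_div, div_neg, mul_div_assoc, div_self hyb.ne]
    linarith
  -- The atoms have total mass `∑ i, N * y i`, so placing them within `ε` of the suprema costs each
  -- moment less than what `F` has to spare.
  obtain ⟨ε, hε, hεk⟩ : ∃ ε : ℝ, 0 < ε ∧ ∀ k, 0 < ∫ v in Icc 0 vbar, φ k v ∂F →
      (∑ i, N * y i) * ε < ∫ v in Icc 0 vbar, φ k v ∂F := by
    have hev : ∀ᶠ ε : ℝ in nhdsWithin 0 (Ioi 0), ∀ k, 0 < ∫ v in Icc 0 vbar, φ k v ∂F →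
        (∑ i, N * y i) * ε < ∫ v in Icc 0 vbar, φ k v ∂F := by
      refine Filter.eventually_all.2 fun k => ?_
      by_cases hk : 0 < ∫ v in Icc 0 vbar, φ k v ∂F
      · have ht : Filter.Tendsto (fun ε : ℝ => (∑ i, N * y i) * ε) (nhds 0) (nhds 0) := by
          simpa using (continuous_const_mul (∑ i, N * y i)).tendsto 0
        exact ((ht.eventually_lt_const hk).filter_mono nhdsWithin_le_nhds).mono fun _ h _ => h
      · exact Filter.Eventually.of_forall fun _ h => absurd h hk
    obtain ⟨ε, h₁, h₂⟩ := (hev.and self_mem_nhdsWithin).exists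
    exact ⟨ε, h₂, h₁⟩
  choose v hvJ hv using fun i => exists_forall_sSup_sub_lt (hne i) (hmono i) (hbdd i) hε
  set ν : Measure ℝ := ∑ i, ENNReal.ofReal (N * y i) • Measure.dirac (v i) with hν
  have hNy : ∀ i, 0 ≤ N * y i := fun i => mul_nonneg hN0 (hy i)
  have hνfin : IsFiniteMeasure ν := by
    rw [hν]
    have : ∀ i, IsFiniteMeasure (ENNReal.ofReal (N * y i) • Measure.dirac (v i)) :=
      fun i => Measure.smul_finite _ ENNReal.ofReal_ne_top
    infer_instance
  have hint : ∀ f : ℝ → ℝ, IntegrableOn f (Icc 0 vbar) F →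
      ∫ u in Icc 0 vbar, f u ∂(ν + F) = ∑ i, N * y i * f (v i) + ∫ u in Icc 0 vbar, f u ∂F := by
    intro f hf
    have hfν : IntegrableOn f (Icc 0 vbar) ν := by
      rw [hν]
      refine Integrable.integrableOn ?_
      refine integrable_finsetSum_measure.2 fun i _ => ?_
      exact (integrable_dirac (by simp)).smul_measure ENNReal.ofReal_ne_top
    rw [Measure.restrict_add, integral_add_measure hfν hf, hν,
      setIntegral_sum_dirac _ _ hNy _ measurableSet_Icc]
    congr 1
    exact Finset.sum_congr rfl fun i _ => by rw [indicator_of_mem (hJ i (hvJ i))]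
  have hνI : ν (Icc 0 vbar)ᶜ = 0 := by
    rw [hν, Measure.finsetSum_apply]
    refine Finset.sum_eq_zero fun i _ => ?_
    simp [Measure.dirac_apply' _ measurableSet_Icc.compl, hJ i (hvJ i)]
  refine absurd (setIntegral_nonneg_of_forall_mem_ambiguitySet h (ν + F) (by simp [hνI, hFI])
    fun k => ?_) (not_le.2 ?_)
  · rw [hint _ ((hφ k).integrableOn F)]
    have hsum : 0 ≤ ∑ i, N * y i * sSup (φ k '' J i) := by
      simpa only [mul_assoc, ← Finset.mul_sum] using mul_nonneg hN0 (hya k)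
    -- For a step function the atoms attain the suprema, so no slack from `F` is needed.
    rcases hFreg k with hfin | hpos
    · refine add_nonneg (hsum.trans_eq (Finset.sum_congr rfl fun i _ => ?_)) (hFφ k)
      rw [(hv i k).2 (hfin.subset (image_mono (hJ i)))]
    · have hle : ∑ i, N * y i * (sSup (φ k '' J i) - ε) ≤ ∑ i, N * y i * φ k (v i) :=
        Finset.sum_le_sum fun i _ => mul_le_mul_of_nonneg_left (hv i k).1.le (hNy i)
      simp only [mul_sub, Finset.sum_sub_distrib, ← Finset.sum_mul] at hle
      linarith [hεk k hpos]
  · rw [hint _ hgint]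
    refine lt_of_eq_of_lt ?_ hN
    rw [Finset.mul_sum]
    congr 1
    exact Finset.sum_congr rfl fun i _ => by rw [hb i _ (hvJ i), mul_assoc]

/-! ### Payments of `n`-level mechanisms -/

section Payment

variable {vbar : ℝ} {n : ℕ} {π : Measure ℝ}

theorem exists_payment_eq_sum (hπ : π ∈ nLevelPricing vbar n) :
    ∃ v x : Fin n → ℝ, (∀ i, 0 ≤ v i) ∧ (∀ i, 0 ≤ x i) ∧
      ∀ u, payment π u = ∑ i, x i * (if v i ≤ u then v i else 0) := by
  obtain ⟨v, x, -, hv, hx, -, rfl⟩ := hπ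
  refine ⟨v, x, fun i => (hv i).1, fun i => (hx i).1, fun u => ?_⟩
  rw [payment, setIntegral_sum_dirac _ _ (fun i => (hx i).1) _ measurableSet_Icc]
  refine Finset.sum_congr rfl fun i _ => ?_
  simp [indicator_apply, (hv i).1]

theorem payment_nonneg (hπ : π ∈ nLevelPricing vbar n) (u : ℝ) : 0 ≤ payment π u := by
  obtain ⟨v, x, hv, hx, h⟩ := exists_payment_eq_sum hπ
  rw [h]
  refine Finset.sum_nonneg fun i _ => mul_nonneg (hx i) ?_
  split_ifs
  exacts [hv i, le_rfl]

theorem measurable_payment (hπ : π ∈ nLevelPricing vbar n) : Measurable (payment π) := by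
  obtain ⟨v, x, -, -, h⟩ := exists_payment_eq_sum hπ
  rw [funext h]
  exact Finset.measurable_sum _ fun i _ => measurable_const.mul
    (Measurable.ite measurableSet_Ici measurable_const measurable_const)

/-- The payment depends only on which prices are at most `u`. This finiteness reduces the dual to
finitely many inequalities. -/
theorem finite_range_payment (hπ : π ∈ nLevelPricing vbar n) : (range (payment π)).Finite := by
  obtain ⟨v, x, -, -, h⟩ := exists_payment_eq_sum hπ
  refine (finite_range fun S : Set (Fin n) => ∑ i, x i * S.indicator v i).subset ?_
  rintro _ ⟨u, rfl⟩
  exact ⟨{i | v i ≤ u}, by simp [h, indicator_apply]⟩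

theorem integrableOn_payment (hπ : π ∈ nLevelPricing vbar n) (F : Measure ℝ) [IsFiniteMeasure F]
    (s : Set ℝ) : IntegrableOn (payment π) s F := by
  obtain ⟨M, hM⟩ := ((finite_range_payment hπ).image fun t => |t|).bddAbove
  exact Integrable.of_bound (C := M) (measurable_payment hπ).aestronglyMeasurable
    (Filter.Eventually.of_forall fun u => hM ⟨_, ⟨u, rfl⟩, rfl⟩)

theorem revenue_nonneg (hπ : π ∈ nLevelPricing vbar n) (F : Measure ℝ) : 0 ≤ revenue vbar π F :=
  integral_nonneg fun u => payment_nonneg hπ u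

end Payment

theorem setIntegral_indicator_Ici {vbar : ℝ} {F : Measure ℝ} (hF : F (Icc 0 vbar)ᶜ = 0)
    (p a : ℝ) :
    ∫ v in Icc 0 vbar, (Ici p).indicator (fun _ => a) v ∂F = a * F.real (Ici p) := by
  have : F.restrict (Icc 0 vbar) = F := Measure.restrict_eq_self_of_ae_mem hF
  rw [this, integral_indicator_const _ measurableSet_Ici, smul_eq_mul, mul_comm]

/-! ### Clairvoyant revenue -/

section OptRevenue

variable {vbar : ℝ} {F : Measure ℝ} [IsProbabilityMeasure F]

theorem one_sub_real_Iio (p : ℝ) : 1 - F.real (Iio p) = F.real (Ici p) := by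
  rw [← compl_Iio, probReal_compl_eq_one_sub measurableSet_Iio]

theorem le_optRevenue {p : ℝ} (hp : p ∈ Icc 0 vbar) :
    p * F.real (Ici p) ≤ optRevenue vbar F := by
  refine le_csSup ⟨vbar, ?_⟩ ⟨p, hp, by simp only [one_sub_real_Iio]⟩
  rintro _ ⟨q, hq, rfl⟩
  simp only [one_sub_real_Iio]
  exact (mul_le_of_le_one_right hq.1 measureReal_le_one).trans hq.2

theorem optRevenue_le (hvbar : 0 ≤ vbar) {B : ℝ}
    (h : ∀ p ∈ Icc 0 vbar, p * F.real (Ici p) ≤ B) : optRevenue vbar F ≤ B := by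
  refine csSup_le ((nonempty_Icc.2 hvbar).image _) ?_
  rintro _ ⟨q, hq, rfl⟩
  simp only [one_sub_real_Iio]
  exact h q hq

end OptRevenue

/-! ### Feasibility and the competitive ratio -/

section Duality

variable {vbar : ℝ} {n K : ℕ} {φ : Fin K → ℝ → ℝ} {r : ℝ} {π : Measure ℝ}

theorem le_competitiveRatio_iff :
    (r : EReal) ≤ competitiveRatio vbar φ π ↔
      ∀ F ∈ ambiguitySet vbar φ, 0 < optRevenue vbar F →
        r * optRevenue vbar F ≤ revenue vbar π F := by
  simp only [competitiveRatio, le_iInf_iff, mem_ofPred_eq, and_imp, EReal.coe_le_coe_iff]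
  exact forall₃_congr fun F _ hF => le_div_iff₀ hF

/-- Weak duality: integrate the constraints for `p` against `F`, drop the nonnegative moment terms,
and take the supremum over `p`. -/
theorem IsFeasible.le_competitiveRatio {lam : Fin K → ℝ → ℝ} (hvbar : 0 < vbar)
    (hφ : ∀ k, PiecewiseNondecreasing vbar (φ k)) (h : IsFeasible vbar n φ r π lam) :
    (r : EReal) ≤ competitiveRatio vbar φ π := by
  refine le_competitiveRatio_iff.2 fun F ⟨hF, hFI, hFφ⟩ hopt => ?_
  have hp : ∀ p ∈ Icc 0 vbar, r * p * F.real (Ici p) ≤ revenue vbar π F := fun p hp => by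
    have hint : IntegrableOn (fun v => ∑ k, φ k v * lam k p) (Icc 0 vbar) F :=
      integrable_finsetSum _ fun k _ => ((hφ k).integrableOn F).mul_const _
    have hind : IntegrableOn ((Ici p).indicator fun _ => r * p) (Icc 0 vbar) F :=
      (integrable_const _).indicator measurableSet_Ici
    have hle : ∫ v in Icc 0 vbar, ((Ici p).indicator (fun _ => r * p) v +
        ∑ k, φ k v * lam k p) ∂F ≤ revenue vbar π F := by
      refine setIntegral_mono_on (hind.add hint) (integrableOn_payment h.mem F _)
        measurableSet_Icc fun v hv => ?_
      by_cases hpv : p ≤ v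
      · simpa [indicator_apply, hpv] using h.above p hp v ⟨hpv, hv.2⟩
      · simpa [indicator_apply, hpv] using h.below p hp v ⟨hv.1, not_le.1 hpv⟩
    rw [integral_add hind hint, setIntegral_indicator_Ici hFI, integral_finsetSum _
      fun k _ => ((hφ k).integrableOn F).mul_const _] at hle
    have : 0 ≤ ∑ k, ∫ v in Icc 0 vbar, φ k v * lam k p ∂F := Finset.sum_nonneg fun k _ => by
      rw [integral_mul_const]
      exact mul_nonneg (hFφ k) (h.nonneg k p hp)
    linarith
  rcases le_or_gt r 0 with hr | hr
  · exact (mul_nonpos_of_nonpos_of_nonneg hr hopt.le).trans (revenue_nonneg h.mem F)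
  · rw [mul_comm, ← le_div_iff₀ hr]
    refine optRevenue_le hvbar.le fun p hpI => ?_
    rw [le_div_iff₀ hr]
    linarith [hp p hpI]

theorem exists_isFeasible_of_le_competitiveRatio
    (hφ : ∀ k, PiecewiseNondecreasing vbar (φ k)) (hreg : IsRegular vbar φ)
    (hπ : π ∈ nLevelPricing vbar n) (hr : (r : EReal) ≤ competitiveRatio vbar φ π) :
    ∃ lam : Fin K → ℝ → ℝ, IsFeasible vbar n φ r π lam := by
  -- For `r < 0` zero multipliers suffice, as payments are nonnegative.
  rcases lt_or_ge r 0 with hr0 | hr0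
  · refine ⟨0, hπ, fun _ _ _ => le_rfl, fun p _ v _ => ?_, fun p hp v _ => ?_⟩
    · simpa using payment_nonneg hπ v
    · have := mul_nonpos_of_nonpos_of_nonneg hr0.le hp.1
      simpa using this.trans (payment_nonneg hπ v)
  rw [le_competitiveRatio_iff] at hr
  have hex : ∀ p, ∃ c : Fin K → ℝ, p ∈ Icc 0 vbar → (∀ k, 0 ≤ c k) ∧ ∀ v ∈ Icc 0 vbar,
      ∑ k, φ k v * c k ≤ payment π v - (Ici p).indicator (fun _ => r * p) v := fun p => by
    by_cases hp : p ∈ Icc 0 vbar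
    swap
    · exact ⟨0, fun h => absurd h hp⟩
    have hfin : ((fun v => payment π v - (Ici p).indicator (fun _ => r * p) v) ''
        Icc 0 vbar).Finite := by
      refine (((finite_range_payment hπ).prod (toFinite {0, r * p})).image
        fun z : ℝ × ℝ => z.1 - z.2).subset ?_
      rintro _ ⟨v, -, rfl⟩
      refine ⟨(payment π v, (Ici p).indicator (fun _ => r * p) v), ⟨⟨v, rfl⟩, ?_⟩, rfl⟩
      by_cases hpv : p ≤ v <;> simp [hpv]
    obtain ⟨c, hc⟩ := exists_multipliers hφ hreg hfin
      ((measurable_payment hπ).sub (measurable_const.indicator measurableSet_Ici))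
      fun F hF => by
        have := hF.1
        rw [integral_sub (integrableOn_payment hπ F _)
          ((integrable_const _).indicator measurableSet_Ici), setIntegral_indicator_Ici hF.2.1,
          sub_nonneg, mul_assoc]
        have hle := mul_le_mul_of_nonneg_left (le_optRevenue (F := F) hp) hr0
        -- The hypothesis says nothing about `F` with zero clairvoyant revenue; there nonnegativity
        -- of the revenue suffices.
        rcases lt_or_ge 0 (optRevenue vbar F) with hopt | hopt
        · exact hle.trans (hr F hF hopt)
        · exact (hle.trans (mul_nonpos_of_nonneg_of_nonpos hr0 hopt)).trans (revenue_nonneg hπ F)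
    exact ⟨c, fun _ => hc⟩
  choose c hc using hex
  refine ⟨fun k p => c p k, hπ, fun k p hp => (hc p hp).1 k, fun p hp v hv => ?_,
    fun p hp v hv => ?_⟩
  · simpa [indicator_apply, not_le.2 hv.2] using
      (hc p hp).2 v ⟨hv.1, hv.2.le.trans hp.2⟩
  · have := (hc p hp).2 v ⟨hp.1.trans hv.1, hv.2⟩
    simp only [indicator_apply, mem_Ici, hv.1, if_true] at this
    linarith

end Duality

end RobustPricing

open RobustPricing in
theorem mainTheorem2 (vbar : ℝ) (hvbar : 0 < vbar) (n : ℕ) (hn : 1 ≤ n) (K : ℕ)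
    (φ : Fin K → ℝ → ℝ)
    (hφ : ∀ k, RobustPricing.PiecewiseNondecreasing vbar (φ k))
    (hreg : RobustPricing.IsRegular vbar φ) :
    -- the two problems have the same value
    RobustPricing.robustValue vbar n φ = RobustPricing.programValue vbar n φ ∧
    -- for each mechanism `π`, the feasible `r` are exactly the ratios that `π` guarantees
    (∀ π ∈ RobustPricing.nLevelPricing vbar n, ∀ r : ℝ,
      (∃ lam : Fin K → ℝ → ℝ, RobustPricing.IsFeasible vbar n φ r π lam) ↔
        (r : EReal) ≤ RobustPricing.competitiveRatio vbar φ π) ∧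
    -- the optimal solutions are the optimal mechanisms with the optimal competitive ratio
    (∀ (r : ℝ) (π : Measure ℝ),
      (∃ lam : Fin K → ℝ → ℝ, RobustPricing.IsOptimalSolution vbar n φ r π lam) ↔
        π ∈ RobustPricing.nLevelPricing vbar n ∧
        RobustPricing.competitiveRatio vbar φ π = (r : EReal) ∧
        RobustPricing.robustValue vbar n φ = (r : EReal)) := by
  have hiff : ∀ π ∈ nLevelPricing vbar n, ∀ r : ℝ,
      (∃ lam : Fin K → ℝ → ℝ, IsFeasible vbar n φ r π lam) ↔
        (r : EReal) ≤ competitiveRatio vbar φ π := fun π hπ r =>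
    ⟨fun ⟨_, h⟩ => h.le_competitiveRatio hvbar hφ,
      exists_isFeasible_of_le_competitiveRatio hφ hreg hπ⟩
  refine ⟨le_antisymm ?_ ?_, hiff, fun r π => ⟨?_, ?_⟩⟩
  -- The ratio may be `+∞`, which no real `r` attains, so it is approached by reals from below.
  · refine iSup₂_le fun π hπ => EReal.ge_of_forall_gt_iff_ge.1 fun s hs => ?_
    obtain ⟨lam, h⟩ := (hiff π hπ s).2 hs.le
    exact le_sSup ⟨s, π, lam, h, rfl⟩
  · refine sSup_le ?_
    rintro _ ⟨r, π, lam, h, rfl⟩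
    exact ((hiff π h.mem r).1 ⟨lam, h⟩).trans (le_iSup₂_of_le π h.mem le_rfl)
  · rintro ⟨lam, h, hopt⟩
    have hle : ∀ π' ∈ nLevelPricing vbar n, competitiveRatio vbar φ π' ≤ r := fun π' hπ' =>
      EReal.ge_of_forall_gt_iff_ge.1 fun s hs => by
        obtain ⟨lam', h'⟩ := (hiff π' hπ' s).2 hs.le
        exact EReal.coe_le_coe_iff.2 (hopt s π' lam' h')
    have hr := (hiff π h.mem r).1 ⟨lam, h⟩
    exact ⟨h.mem, le_antisymm (hle π h.mem) hr,
      le_antisymm (iSup₂_le hle) (hr.trans (le_iSup₂_of_le π h.mem le_rfl))⟩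
  · rintro ⟨hπ, hr, hval⟩
    obtain ⟨lam, h⟩ := (hiff π hπ r).2 hr.ge
    refine ⟨lam, h, fun r' π' lam' h' => EReal.coe_le_coe_iff.1 ?_⟩
    rw [← hval]
    exact ((hiff π' h'.mem r').1 ⟨lam', h'⟩).trans (le_iSup₂_of_le π' h'.mem le_rfl)
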